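/- Let $G$ be a group. A biautomatic structure $(\mathcal A,\mathcal L)$ on $G$ consists of a finite set $\mathcal A$ with a map $\mu:\mathcal A\to G$ whose extension $\mu:\mathcal A^*\to G$ to the free monoid is surjective and with an involution $a\mapsto a^{-1}$ of $\mathcal A$ satisfying $\mu(a^{-1})=\mu(a)^{-1}$, together with a regular language $\mathcal L\subseteq\mathcal A^*$ such that $\mu(\mathcal L)=G$ and such that there is $\zeta\ge 0$ with the following property: whenever $p,q$ are edge paths in the Cayley graph $\Gamma(G,\mathcal A)$ labelled by words of $\mathcal L$, whose initial vertices are at distance at most $1$ and whose terminal vertices are at distance at most $1$, then $d_{\mathcal A}(\hat p(t),\hat q(t))\le\zeta$ for all integers $t\ge 0$. Here $d_{\mathcal A}$ is the graph metric, and $\hat p(t)$ is the $t$-th vertex of $p$ if $t\le |p|$ and the terminal vertex of $p$ if $t>|p|$. A subgroup $H\leqslant G$ is $\mathcal L$-quasiconvex if there is $\varkappa\ge 0$ such that for every path in $\Gamma(G,\mathcal A)$ that starts at $1_G$, ends at an element of $H$ and is labelled by a word of $\mathcal L$, every vertex of the path is at distance at most $\varkappa$ from $H$. The commensurator $\mathrm{Comm}_G(H)$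 is the subgroup of all $g\in G$ such that $H\cap gHg^{-1}$ has finite index in both $H$ and $gHg^{-1}$. The abstract commensurator $\mathrm{Comm}(H)$ is the group of equivalence classes of isomorphisms $\phi:H_1\to H_2$ between finite-index subgroups of $H$, where two isomorphisms are equivalent if they agree on a finite-index subgroup of $H$ contained in both domains, and where the product of the classes of $\psi$ and $\phi$ is the class of $\psi\circ\phi$, defined on $\phi^{-1}$ of the domain of $\psi$. Conjugation $h\mapsto ghg^{-1}$, restricted to $H\cap g^{-1}Hg\to H\cap gHg^{-1}$, gives a natural homomorphism $\mathrm{Comm}_G(H)\to\mathrm{Comm}(H)$. **Theorem.** Suppose that $G$ is a group with a biautomatic structure $(\mathcal A,\mathcal L)$, and $H\leqslant G$ is an $\mathcal L$-quasiconvex abelian subgroup. Then $\mathrm{Comm}_G(H)$ has finite image in $\mathrm{Comm}(H)$ under the natural homomorphism. In particular, there is a finite-index normal subgroup $\mathrm{Comm}^0_G(H)\lhd\mathrm{Comm}_G(H)$ such that every finitely generated subgroup of $\mathrm{Comm}^0_G(H)$ centralizes a finite-index subgroup of $H$. -/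

import Mathlib

/-! ### Words, word metrics and biautomatic structures -/

section Words

variable {G : Type*} [Group G] {A : Type*}

/-- The element of `G` represented by the word `W` over the alphabet `A`: the extension of
`μ : A → G` to the free monoid on `A`. -/
def wordValue (μ : A → G) (W : List A) : G := (W.map μ).prod

/-- The length `|g|_A` of a shortest word representing `g`.  It is used only when every element
of `G` is represented by some word. -/
noncomputable def wordNorm (μ : A → G) (g : G) : ℕ :=
  sInf {n : ℕ | ∃ W : List A, wordValue μ W = g ∧ W.length = n}

/-- The distance `d_A` between two vertices of the Cayley graph, whose edges join `g` to
`g * μ a`. -/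
noncomputable def wordDist (μ : A → G) (g h : G) : ℕ := wordNorm μ (g⁻¹ * h)

/-- The vertex reached at time `t` by the edge path of the Cayley graph that starts at `g` and is
labelled by `W`; after the end of the path it stays at the end point. -/
def pathVertex (μ : A → G) (g : G) (W : List A) (t : ℕ) : G := g * wordValue μ (W.take t)

end Words

/-- A biautomatic structure on the group `G` with alphabet `A`. -/
structure BiautomaticStructure (G : Type*) [Group G] (A : Type*) where
  /-- the map from the alphabet to the group -/
  μ : A → G
  /-- the formal inversion of letters -/
  ι : A → A
  /-- the language of the structure -/
  lang : Language A
  finite_alphabet : Finite A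
  involutive_ι : Function.Involutive ι
  μ_ι : ∀ a, μ (ι a) = (μ a)⁻¹
  generates : Function.Surjective (wordValue μ)
  /-- every element of the group is represented by a word of the language -/
  lang_surjective : ∀ g : G, ∃ W ∈ lang, wordValue μ W = g
  regular : lang.IsRegular
  /-- paths labelled by words of the language which start and end at distance at most one
  uniformly fellow travel -/
  fellow_travel : ∃ ζ : ℕ, ∀ g h : G, ∀ U ∈ lang, ∀ V ∈ lang,
    wordDist μ g h ≤ 1 → wordDist μ (g * wordValue μ U) (h * wordValue μ V) ≤ 1 →
    ∀ t : ℕ, wordDist μ (pathVertex μ g U t) (pathVertex μ h V t) ≤ ζ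

/-- The subgroup `H` is quasiconvex with respect to the language of the structure `S`: for some
`κ`, every vertex of a path that starts at `1`, ends in `H` and is labelled by a word of the
language lies at distance at most `κ` from `H`. -/
def BiautomaticStructure.IsQuasiconvex {G : Type*} [Group G] {A : Type*}
    (S : BiautomaticStructure G A) (H : Subgroup G) : Prop :=
  ∃ κ : ℕ, ∀ W ∈ S.lang, wordValue S.μ W ∈ H →
    ∀ t : ℕ, ∃ h ∈ H, wordDist S.μ (pathVertex S.μ 1 W t) h ≤ κ

/-! ### The abstract commensurator -/

/-- An isomorphism between two subgroups of finite index of `G`. -/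
structure PartialIso (G : Type*) [Group G] where
  dom : Subgroup G
  cod : Subgroup G
  finiteIndex_dom : dom.FiniteIndex
  finiteIndex_cod : cod.FiniteIndex
  toEquiv : dom ≃* cod

namespace PartialIso

variable {G : Type*} [Group G]

/-- The inverse isomorphism. -/
def symm (φ : PartialIso G) : PartialIso G where
  dom := φ.cod
  cod := φ.dom
  finiteIndex_dom := φ.finiteIndex_cod
  finiteIndex_cod := φ.finiteIndex_dom
  toEquiv := φ.toEquiv.symm

/-- The image `φ (dom ⊓ K)` of a subgroup. -/
def image (φ : PartialIso G) (K : Subgroup G) : Subgroup G :=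
  (K.subgroupOf φ.dom).map (φ.cod.subtype.comp φ.toEquiv.toMonoidHom)

theorem mem_image {φ : PartialIso G} {K : Subgroup G} {y : G} :
    y ∈ φ.image K ↔ ∃ x : φ.dom, (x : G) ∈ K ∧ (φ.toEquiv x : G) = y :=
  Iff.rfl

theorem mem_image_symm {φ : PartialIso G} {K : Subgroup G} {x : G} :
    x ∈ φ.symm.image K ↔ ∃ h : x ∈ φ.dom, (φ.toEquiv ⟨x, h⟩ : G) ∈ K := by
  rw [mem_image]
  constructor
  · rintro ⟨y, hy, rfl⟩
    have h : φ.toEquiv (φ.toEquiv.symm y) = y := MulEquiv.apply_symm_apply _ _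
    exact ⟨(φ.toEquiv.symm y).2, (congrArg Subtype.val h).symm ▸ hy⟩
  · rintro ⟨h, hK⟩
    refine ⟨φ.toEquiv ⟨x, h⟩, hK, ?_⟩
    change (φ.toEquiv.symm (φ.toEquiv ⟨x, h⟩) : G) = x
    rw [MulEquiv.symm_apply_apply]

theorem finiteIndex_image (φ : PartialIso G) (K : Subgroup G) (hK : K.FiniteIndex) :
    (φ.image K).FiniteIndex := by
  have h1 : (K.subgroupOf φ.dom).index ≠ 0 := by
    have := hK
    exact (inferInstance : (K.subgroupOf φ.dom).FiniteIndex).index_ne_zero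
  have h2 : ((K.subgroupOf φ.dom).map φ.toEquiv.toMonoidHom).index ≠ 0 := by
    have := Subgroup.index_map_equiv (K.subgroupOf φ.dom) φ.toEquiv
    exact fun h => h1 (this.symm.trans h)
  refine ⟨?_⟩
  rw [image, ← Subgroup.map_map, Subgroup.index_map_subtype]
  exact mul_ne_zero h2 φ.finiteIndex_cod.index_ne_zero

/-- The composite `ψ ∘ φ`, an isomorphism from `φ⁻¹ (cod φ ⊓ dom ψ)` onto
`ψ (cod φ ⊓ dom ψ)`. -/
def comp (ψ φ : PartialIso G) : PartialIso G where
  dom := φ.symm.image ψ.dom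
  cod := ψ.image φ.cod
  finiteIndex_dom := φ.symm.finiteIndex_image _ ψ.finiteIndex_dom
  finiteIndex_cod := ψ.finiteIndex_image _ φ.finiteIndex_cod
  toEquiv :=
    { toFun := fun x =>
        ⟨ψ.toEquiv ⟨φ.toEquiv ⟨x, (mem_image_symm.1 x.2).1⟩, (mem_image_symm.1 x.2).2⟩,
          mem_image.2 ⟨_, (φ.toEquiv _).2, rfl⟩⟩
      invFun := fun y =>
        ⟨φ.toEquiv.symm ⟨ψ.toEquiv.symm ⟨y, (mem_image_symm (φ := ψ.symm).1 y.2).1⟩,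
          (mem_image_symm (φ := ψ.symm).1 y.2).2⟩,
          mem_image.2 ⟨_, (ψ.toEquiv.symm _).2, rfl⟩⟩
      left_inv := fun x => by
        have h1 := congrArg Subtype.val (φ.toEquiv.symm_apply_apply ⟨x, (mem_image_symm.1 x.2).1⟩)
        have h2 := congrArg Subtype.val
          (ψ.toEquiv.symm_apply_apply ⟨_, (mem_image_symm.1 x.2).2⟩)
        refine Subtype.ext (Eq.trans ?_ h1)
        exact congrArg (fun z => (φ.toEquiv.symm z : G)) (Subtype.ext h2)
      right_inv := fun y => by
        have h1 := congrArg Subtype.val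
          (ψ.toEquiv.apply_symm_apply ⟨y, (mem_image_symm (φ := ψ.symm).1 y.2).1⟩)
        have h2 := congrArg Subtype.val
          (φ.toEquiv.apply_symm_apply ⟨_, (mem_image_symm (φ := ψ.symm).1 y.2).2⟩)
        refine Subtype.ext (Eq.trans ?_ h1)
        exact congrArg (fun z => (ψ.toEquiv z : G)) (Subtype.ext h2)
      map_mul' := fun x y => by
        have h1 := congrArg Subtype.val
          (φ.toEquiv.map_mul ⟨x, (mem_image_symm.1 x.2).1⟩ ⟨y, (mem_image_symm.1 y.2).1⟩)
        have h2 := congrArg Subtype.val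
          (ψ.toEquiv.map_mul ⟨_, (mem_image_symm.1 x.2).2⟩ ⟨_, (mem_image_symm.1 y.2).2⟩)
        refine Subtype.ext (Eq.trans ?_ h2)
        exact congrArg (fun z => (ψ.toEquiv z : G)) (Subtype.ext h1) }

/-- Two isomorphisms are equivalent if they agree on a subgroup of finite index. -/
def Equivalent (φ ψ : PartialIso G) : Prop :=
  ∃ K : Subgroup G, K.FiniteIndex ∧ ∃ (hφ : K ≤ φ.dom) (hψ : K ≤ ψ.dom),
    ∀ (x : G) (hx : x ∈ K), (φ.toEquiv ⟨x, hφ hx⟩ : G) = ψ.toEquiv ⟨x, hψ hx⟩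

theorem Equivalent.refl (φ : PartialIso G) : φ.Equivalent φ :=
  ⟨φ.dom, φ.finiteIndex_dom, le_rfl, le_rfl, fun _ _ => rfl⟩

theorem Equivalent.symm {φ ψ : PartialIso G} : φ.Equivalent ψ → ψ.Equivalent φ :=
  fun ⟨K, hK, h1, h2, h⟩ => ⟨K, hK, h2, h1, fun x hx => (h x hx).symm⟩

theorem Equivalent.trans {φ ψ χ : PartialIso G} :
    φ.Equivalent ψ → ψ.Equivalent χ → φ.Equivalent χ := by
  rintro ⟨K, hK, h1, h2, h⟩ ⟨K', hK', h1', h2', h'⟩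
  exact ⟨K ⊓ K', inferInstance, inf_le_left.trans h1, inf_le_right.trans h2',
    fun x hx => (h x hx.1).trans (h' x hx.2)⟩

instance setoid (G : Type*) [Group G] : Setoid (PartialIso G) where
  r := Equivalent
  iseqv := ⟨Equivalent.refl, Equivalent.symm, Equivalent.trans⟩

/-- The identity isomorphism. -/
def id (G : Type*) [Group G] : PartialIso G where
  dom := ⊤
  cod := ⊤
  finiteIndex_dom := inferInstance
  finiteIndex_cod := inferInstance
  toEquiv := MulEquiv.refl _

theorem Equivalent.comp {ψ ψ' φ φ' : PartialIso G} :
    ψ.Equivalent ψ' → φ.Equivalent φ' → (ψ.comp φ).Equivalent (ψ'.comp φ') := by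
  rintro ⟨K, hK, h1, h2, h⟩ ⟨K', hK', h1', h2', h'⟩
  have hfin : (φ.symm.image K).FiniteIndex := φ.symm.finiteIndex_image _ hK
  refine ⟨φ.symm.image K ⊓ K', inferInstance, ?_, ?_, ?_⟩
  · rintro x ⟨hx, -⟩
    obtain ⟨hd, hxK⟩ := mem_image_symm.1 hx
    exact mem_image_symm.2 ⟨hd, h1 hxK⟩
  · rintro x ⟨hx, hx'⟩
    obtain ⟨hd, hxK⟩ := mem_image_symm.1 hx
    refine mem_image_symm.2 ⟨h2' hx', ?_⟩
    rw [← h' x hx']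
    exact h2 hxK
  · rintro x ⟨hx, hx'⟩
    obtain ⟨hd, hxK⟩ := mem_image_symm.1 hx
    refine (h _ hxK).trans ?_
    change (ψ'.toEquiv _ : G) = ψ'.toEquiv _
    congr 2
    exact Subtype.ext (h' x hx')

theorem Equivalent.inverse {φ φ' : PartialIso G} :
    φ.Equivalent φ' → φ.symm.Equivalent φ'.symm := by
  rintro ⟨K, hK, h1, h2, h⟩
  refine ⟨φ.image K, φ.finiteIndex_image _ hK, ?_, ?_, ?_⟩
  · rintro y hy
    obtain ⟨x, hx, rfl⟩ := mem_image.1 hy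
    exact (φ.toEquiv x).2
  · rintro y hy
    obtain ⟨x, hx, rfl⟩ := mem_image.1 hy
    rw [h x hx]
    exact (φ'.toEquiv _).2
  · rintro y hy
    obtain ⟨x, hx, rfl⟩ := mem_image.1 hy
    exact congrArg Subtype.val (φ.toEquiv.symm_apply_apply x) |>.trans
      (congrArg Subtype.val ((congrArg φ'.toEquiv.symm (Subtype.ext (h x hx))).trans
        (φ'.toEquiv.symm_apply_apply ⟨x, h2 hx⟩))).symm

end PartialIso

/-- The abstract commensurator of `G`: equivalence classes of isomorphisms between subgroups of
finite index of `G`. -/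
def AbstractCommensurator (G : Type*) [Group G] : Type _ := Quotient (PartialIso.setoid G)

namespace AbstractCommensurator

/-- The product of the classes of `ψ` and `φ` is the class of `ψ ∘ φ`. -/
instance group (G : Type*) [Group G] : Group (AbstractCommensurator G) where
  mul := Quotient.map₂ PartialIso.comp fun _ _ h _ _ h' => h.comp h'
  one := Quotient.mk _ (PartialIso.id G)
  inv := Quotient.map PartialIso.symm fun _ _ h => h.inverse
  mul_assoc := by
    rintro ⟨χ⟩ ⟨ψ⟩ ⟨φ⟩
    refine Quotient.sound ⟨((χ.comp ψ).comp φ).dom, ((χ.comp ψ).comp φ).finiteIndex_dom, le_rfl,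
      ?_, fun x hx => rfl⟩
    intro x hx
    obtain ⟨h1, h2⟩ := PartialIso.mem_image_symm.1 hx
    obtain ⟨h3, h4⟩ := PartialIso.mem_image_symm.1 h2
    exact PartialIso.mem_image_symm.2 ⟨PartialIso.mem_image_symm.2 ⟨h1, h3⟩, h4⟩
  one_mul := by
    rintro ⟨φ⟩
    exact Quotient.sound ⟨φ.dom, φ.finiteIndex_dom,
      fun x hx => PartialIso.mem_image_symm.2 ⟨hx, trivial⟩, le_rfl, fun x hx => rfl⟩
  mul_one := by
    rintro ⟨φ⟩
    exact Quotient.sound ⟨φ.dom, φ.finiteIndex_dom,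
      fun x hx => PartialIso.mem_image_symm.2 ⟨trivial, hx⟩, le_rfl, fun x hx => rfl⟩
  inv_mul_cancel := by
    rintro ⟨φ⟩
    refine Quotient.sound ⟨φ.dom, φ.finiteIndex_dom,
      fun x hx => PartialIso.mem_image_symm.2 ⟨hx, (φ.toEquiv _).2⟩, le_top, fun x hx => ?_⟩
    change (φ.toEquiv.symm (φ.toEquiv ⟨x, hx⟩) : G) = x
    rw [MulEquiv.symm_apply_apply]

end AbstractCommensurator

/-! ### The map from the commensurator to the abstract commensurator -/

section CommensuratorMap

open Subgroup.Commensurable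

variable {G : Type*} [Group G]

/-- The subgroup `{h ∈ H | g * h * g⁻¹ ∈ H}` of `H`. -/
def conjDom (H : Subgroup G) (g : G) : Subgroup H :=
  H.comap ((MulAut.conj g).toMonoidHom.comp H.subtype)

theorem mem_conjDom {H : Subgroup G} {g : G} {h : H} :
    h ∈ conjDom H g ↔ g * h * g⁻¹ ∈ H := Iff.rfl

theorem finiteIndex_conjDom (H : Subgroup G) (g : commensurator H) :
    (conjDom H (g : G)).FiniteIndex := by
  have h := ((commensurator_mem_iff H _).1 (g⁻¹).2).1
  refine ⟨?_⟩
  rw [Subgroup.relIndex] at h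
  convert h using 2
  ext x
  rw [mem_conjDom, Subgroup.mem_subgroupOf, Subgroup.mem_pointwise_smul_iff_inv_smul_mem,
    ← map_inv, ConjAct.toConjAct_smul]
  simp

/-- Conjugation by an element `g` of the commensurator of `H`, as an isomorphism
`H ⊓ g⁻¹ H g → H ⊓ g H g⁻¹`, `h ↦ g * h * g⁻¹`, between subgroups of finite index of `H`. -/
def conjPartialIso (H : Subgroup G) (g : commensurator H) : PartialIso H where
  dom := conjDom H g
  cod := conjDom H (g⁻¹ : commensurator H)
  finiteIndex_dom := finiteIndex_conjDom H g
  finiteIndex_cod := finiteIndex_conjDom H g⁻¹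
  toEquiv :=
    { toFun := fun x => ⟨⟨g * (x : H) * (g : G)⁻¹, x.2⟩, by
        rw [mem_conjDom]; simp [mul_assoc]⟩
      invFun := fun y => ⟨⟨(g : G)⁻¹ * (y : H) * g, by
        have := mem_conjDom.1 y.2; simpa using this⟩, by
        rw [mem_conjDom]; simp [mul_assoc]⟩
      left_inv := fun x => by ext; simp [mul_assoc]
      right_inv := fun y => by ext; simp [mul_assoc]
      map_mul' := fun x y => by ext; simp [mul_assoc] }

/-- The natural homomorphism from the commensurator of `H` in `G` to the abstract commensurator
of `H`, sending `g` to the class of conjugation by `g`. -/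
def commensuratorMap (H : Subgroup G) : commensurator H →* AbstractCommensurator H where
  toFun g := Quotient.mk _ (conjPartialIso H g)
  map_one' := Quotient.sound ⟨conjDom H (1 : commensurator H), finiteIndex_conjDom H 1, le_rfl,
    le_top, fun x hx => by
      change (⟨(1 : G) * x * (1 : G)⁻¹, _⟩ : H) = x
      ext; simp⟩
  map_mul' g g' := by
    refine Quotient.sound (PartialIso.Equivalent.symm
      ⟨_, ((conjPartialIso H g).comp (conjPartialIso H g')).finiteIndex_dom, le_rfl, ?_, ?_⟩)
    · intro x hx
      obtain ⟨h1, h2⟩ := PartialIso.mem_image_symm.1 hx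
      have h3 : (g : G) * (g' * x * (g' : G)⁻¹) * (g : G)⁻¹ ∈ H := h2
      change ((g * g' : commensurator H) : G) * x * ((g * g' : commensurator H) : G)⁻¹ ∈ H
      simpa [mul_assoc] using h3
    · intro x hx
      ext
      change (g : G) * (g' * x * (g' : G)⁻¹) * (g : G)⁻¹ =
        ((g * g' : commensurator H) : G) * x * ((g * g' : commensurator H) : G)⁻¹
      simp [mul_assoc]

end CommensuratorMap

/-!
Why the image of the commensurator is finite.

The group `H` is finitely generated, hence up to a finite kernel it is a lattice in a real vector
space `V`, and an element `g` of the commensurator acts on `V` by a linear automorphism, which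
determines the class of conjugation by `g` in the abstract commensurator. So it is enough to find a
polytope spanning `V` that is preserved by all these automorphisms: they permute its extreme points,
and only finitely many linear maps do so (`finite_setOf_linearEquiv_image_convexHull_eq`).

The polytope comes from the loops of a finite automaton. Let `W` be a long word of the language
with value in `H`. By quasiconvexity its path stays near `H`, so two of its vertices have the same
state and the same position relative to `H`. The subword between them can be removed or repeated,
which multiplies the value by an element `b` of `H`; as `H` is abelian, there are only finitely
many such pairs `(b, n)`, where `n` is the length of the subword
(`BiautomaticStructure.IsQuasiconvex.exists_finite_loops`). The polytope is the convex hull of the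
origin and of the directions `b / n`.

To see that it is preserved by conjugation, write `ℓ h` for the length of a shortest word of the
language with value `h`. Fellow travelling gives `ℓ (g * h * x) ≤ ℓ h + C` with `C` depending only
on `g` and `x` (`BiautomaticStructure.exists_length_le`), because a word that is much longer than
the one it fellow travels with lingers in a ball and can be shortened. Pumping a loop gives
`ℓ (b ^ k) ≤ k * n + O(1)`, hence `ℓ (g * b ^ k * g⁻¹) ≤ k * n + O(1)`. On the other hand, an element
`h` of `H` is a product of loops and of a bounded remainder, with loops of total length at most
`ℓ h`, that is, `h` lies within bounded distance of `ℓ h` times the polytope. Dividing by `k * n`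
and letting `k` tend to infinity shows that the image of `b / n` lies in the polytope
(`BiautomaticStructure.image_loopPolytope_subset`).

The kernel of the map to the abstract commensurator is then the required normal subgroup: each of its
elements centralizes a subgroup of finite index in `H`, and finitely many such subgroups intersect
in a subgroup of finite index.
-/

/-! ### Words and balls -/

section Words

variable {G : Type*} [Group G] {A : Type*} {μ : A → G}

@[simp]
theorem wordValue_nil : wordValue μ [] = 1 := rfl

@[simp]
theorem wordValue_singleton (a : A) : wordValue μ [a] = μ a := by simp [wordValue]

@[simp]
theorem wordValue_append (U V : List A) :
    wordValue μ (U ++ V) = wordValue μ U * wordValue μ V := by simp [wordValue]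

@[simp]
theorem wordValue_flatten_replicate (k : ℕ) (U : List A) :
    wordValue μ (List.replicate k U).flatten = wordValue μ U ^ k := by
  induction k with
  | zero => simp
  | succ k ih => rw [List.replicate_succ, List.flatten_cons, wordValue_append, ih, pow_succ']

theorem wordNorm_wordValue_le (U : List A) : wordNorm μ (wordValue μ U) ≤ U.length :=
  Nat.sInf_le ⟨U, rfl, rfl⟩

theorem exists_wordValue_eq_length_eq_wordNorm (hμ : Function.Surjective (wordValue μ)) (g : G) :
    ∃ U : List A, wordValue μ U = g ∧ U.length = wordNorm μ g := by
  obtain ⟨U, hU⟩ := hμ g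
  exact Nat.sInf_mem (s := {n | ∃ W : List A, wordValue μ W = g ∧ W.length = n}) ⟨_, U, hU, rfl⟩

theorem finite_setOf_wordNorm_le [Finite A] (hμ : Function.Surjective (wordValue μ)) (n : ℕ) :
    {g : G | wordNorm μ g ≤ n}.Finite := by
  refine ((List.finite_length_le A n).image (wordValue μ)).subset fun g hg => ?_
  obtain ⟨U, hU, hl⟩ := exists_wordValue_eq_length_eq_wordNorm hμ g
  exact ⟨U, hl.trans_le hg, hU⟩

end Words

/-! ### Pumping in regular languages -/

/-- A word of a regular language whose prefixes are observed through a function `f` with values in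
a finite set `X` contains, in every window of a length depending only on the language and on `X`,
a nonempty subword that can be pumped and at whose two ends `f` takes the same value. -/
theorem Language.IsRegular.exists_pumping {A β : Type*} {L : Language A} (hL : L.IsRegular)
    {X : Set β} (hX : X.Finite) :
    ∃ N : ℕ, ∀ W ∈ L, ∀ (f : ℕ → β) (s : ℕ), s + N ≤ W.length →
      (∀ t, s ≤ t → t ≤ s + N → f t ∈ X) →
      ∃ W₁ U W₂ : List A, W = W₁ ++ U ++ W₂ ∧ U ≠ [] ∧ s ≤ W₁.length ∧
        W₁.length + U.length ≤ s + N ∧ f W₁.length = f (W₁.length + U.length) ∧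
        ∀ k : ℕ, W₁ ++ (List.replicate k U).flatten ++ W₂ ∈ L := by
  classical
  obtain ⟨σ, _, M, rfl⟩ := hL
  refine ⟨(Finset.univ (α := σ) ×ˢ hX.toFinset).card, fun W hW f s hs hf => ?_⟩
  set N := (Finset.univ (α := σ) ×ˢ hX.toFinset).card
  have hcard : (Finset.univ (α := σ) ×ˢ hX.toFinset).card < (Finset.Icc s (s + N)).card := by
    rw [Nat.card_Icc]; omega
  obtain ⟨i, j, hi, hj, hij, hM, hfij⟩ : ∃ i j, s ≤ i ∧ j ≤ s + N ∧ i < j ∧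
      M.eval (W.take i) = M.eval (W.take j) ∧ f i = f j := by
    obtain ⟨i, hi, j, hj, hne, h⟩ := Finset.exists_ne_map_eq_of_card_lt_of_maps_to hcard
      (f := fun t => (M.eval (W.take t), f t)) (fun t ht => by
        have := Finset.mem_Icc.1 ht
        simpa using hf t this.1 this.2)
    rw [Finset.mem_Icc] at hi hj
    have h' := Prod.mk.inj h
    rcases lt_or_gt_of_ne hne with hlt | hlt
    · exact ⟨i, j, hi.1, hj.2, hlt, h'⟩
    · exact ⟨j, i, hj.1, hi.2, hlt, h'.1.symm, h'.2.symm⟩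
  have hjW : j ≤ W.length := hj.trans hs
  have htake : W.take i ++ (W.take j).drop i = W.take j := by
    conv_rhs => rw [← List.take_append_drop i (W.take j)]
    rw [List.take_take, min_eq_left hij.le]
  have hl1 : (W.take i).length = i := by simp; omega
  have hl2 : ((W.take j).drop i).length = j - i := by simp; omega
  refine ⟨W.take i, (W.take j).drop i, W.drop j, ?_, ?_, ?_, ?_, ?_, fun k => ?_⟩
  · rw [htake, List.take_append_drop]
  · intro h
    rw [h, List.length_nil] at hl2
    omega
  · omega
  · omega
  · rw [hl1, hl2, hfij]
    congr 1
    omega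
  · have hloop : M.evalFrom (M.eval (W.take i)) ((W.take j).drop i) = M.eval (W.take i) := by
      rw [DFA.eval, ← DFA.evalFrom_of_append, htake]
      exact hM.symm
    have hrep : M.evalFrom (M.eval (W.take i)) (List.replicate k ((W.take j).drop i)).flatten =
        M.eval (W.take i) := by
      induction k with
      | zero => rfl
      | succ k ih => rw [List.replicate_succ, List.flatten_cons, DFA.evalFrom_of_append, hloop, ih]
    rw [DFA.mem_accepts, DFA.eval, DFA.evalFrom_of_append, DFA.evalFrom_of_append]
    change M.evalFrom (M.evalFrom (M.eval (W.take i)) _) _ ∈ M.accept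
    rw [hrep, hM, DFA.eval, ← DFA.evalFrom_of_append, List.take_append_drop]
    exact hW

namespace BiautomaticStructure

variable {G : Type*} [Group G] {A : Type*} (S : BiautomaticStructure G A)

/-! ### Lengths of words of the language under translation -/

/-- Moving the end points of the paths of the language by at most one changes the length of a
shortest representative by a bounded amount: once the path of `W` has ended, a path fellow
travelling with it remains in a ball, and if it stays there for long, then it can be shortened. -/
theorem exists_length_le_of_wordNorm_le_one (g x : G) (hg : wordNorm S.μ g⁻¹ ≤ 1)
    (hx : wordNorm S.μ x ≤ 1) :
    ∃ C : ℕ, ∀ W ∈ S.lang, ∃ V ∈ S.lang, wordValue S.μ V = g * wordValue S.μ W * x ∧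
      V.length ≤ W.length + C := by
  have := S.finite_alphabet
  obtain ⟨ζ, hζ⟩ := S.fellow_travel
  obtain ⟨C, hC⟩ := S.regular.exists_pumping (finite_setOf_wordNorm_le S.generates ζ)
  refine ⟨C, fun W hW => ?_⟩
  obtain ⟨V₀, hV₀, hV₀v⟩ := S.lang_surjective (g * wordValue S.μ W * x)
  obtain ⟨V, ⟨hV, hVv⟩, hmin⟩ := exists_minimalFor_of_wellFoundedLT
    (fun V => V ∈ S.lang ∧ wordValue S.μ V = g * wordValue S.μ W * x) List.length ⟨V₀, hV₀, hV₀v⟩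
  refine ⟨V, hV, hVv, ?_⟩
  by_contra! hlt
  have hnear : ∀ t, W.length ≤ t → t ≤ W.length + C →
      (g * wordValue S.μ W)⁻¹ * wordValue S.μ (V.take t) ∈ {y : G | wordNorm S.μ y ≤ ζ} := by
    intro t ht _
    have h := hζ g 1 W hW V hV (by simpa [wordDist] using hg)
      (by simpa [wordDist, hVv, mul_assoc] using hx) t
    simpa [wordDist, pathVertex, List.take_of_length_le ht, mul_assoc] using h
  obtain ⟨W₁, U, W₂, rfl, hU, hs, hl, hf, hpump⟩ := hC V hV
    (fun t => (g * wordValue S.μ W)⁻¹ * wordValue S.μ (V.take t)) W.length hlt.le hnear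
  have h0 := hpump 0
  have htake₁ : (W₁ ++ U ++ W₂).take W₁.length = W₁ := by simp
  have htake₂ : (W₁ ++ U ++ W₂).take (W₁.length + U.length) = W₁ ++ U := by
    rw [← List.length_append, List.take_left']
    rfl
  rw [htake₁, htake₂, mul_right_inj] at hf
  have hlen := hmin (j := W₁ ++ W₂) ⟨by simpa using h0, by
    rw [← hVv, wordValue_append, wordValue_append, ← hf]⟩ (by simp)
  have := List.length_pos_iff.2 hU
  simp only [List.length_append] at hlen
  omega

/-- Multiplying the value of a word of the language by fixed elements on the left and on the right
changes the length of a shortest representative by a bounded amount. -/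
theorem exists_length_le (g x : G) :
    ∃ C : ℕ, ∀ W ∈ S.lang, ∃ V ∈ S.lang, wordValue S.μ V = g * wordValue S.μ W * x ∧
      V.length ≤ W.length + C := by
  have hμ (a : A) : wordNorm S.μ (S.μ a) ≤ 1 := by
    simpa using wordNorm_wordValue_le (μ := S.μ) [a]
  have h1 : wordNorm S.μ 1 ≤ 1 := by
    simpa using (wordNorm_wordValue_le (μ := S.μ) []).trans zero_le_one
  have hleft : ∀ U : List A, ∃ C : ℕ, ∀ W ∈ S.lang, ∃ V ∈ S.lang,
      wordValue S.μ V = wordValue S.μ U * wordValue S.μ W ∧ V.length ≤ W.length + C := by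
    intro U
    induction U with
    | nil => exact ⟨0, fun W hW => ⟨W, hW, by simp, le_rfl⟩⟩
    | cons a U ih =>
      obtain ⟨C, hC⟩ := ih
      obtain ⟨D, hD⟩ := S.exists_length_le_of_wordNorm_le_one (S.μ a) 1
        (by rw [← S.μ_ι]; exact hμ _) h1
      refine ⟨C + D, fun W hW => ?_⟩
      obtain ⟨V, hV, hVv, hVl⟩ := hC W hW
      obtain ⟨V', hV', hV'v, hV'l⟩ := hD V hV
      refine ⟨V', hV', ?_, by omega⟩
      rw [hV'v, hVv, ← List.singleton_append, wordValue_append, wordValue_singleton]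
      group
  have hright : ∀ U : List A, ∃ C : ℕ, ∀ W ∈ S.lang, ∃ V ∈ S.lang,
      wordValue S.μ V = wordValue S.μ W * wordValue S.μ U ∧ V.length ≤ W.length + C := by
    intro U
    induction U with
    | nil => exact ⟨0, fun W hW => ⟨W, hW, by simp, le_rfl⟩⟩
    | cons a U ih =>
      obtain ⟨C, hC⟩ := ih
      obtain ⟨D, hD⟩ := S.exists_length_le_of_wordNorm_le_one 1 (S.μ a) (by simpa using h1) (hμ a)
      refine ⟨D + C, fun W hW => ?_⟩
      obtain ⟨V, hV, hVv, hVl⟩ := hD W hW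
      obtain ⟨V', hV', hV'v, hV'l⟩ := hC V hV
      refine ⟨V', hV', ?_, by omega⟩
      rw [hV'v, hVv, ← List.singleton_append (x := a), wordValue_append, wordValue_singleton]
      group
  obtain ⟨U, rfl⟩ := S.generates g
  obtain ⟨U', rfl⟩ := S.generates x
  obtain ⟨C, hC⟩ := hleft U
  obtain ⟨D, hD⟩ := hright U'
  refine ⟨C + D, fun W hW => ?_⟩
  obtain ⟨V, hV, hVv, hVl⟩ := hC W hW
  obtain ⟨V', hV', hV'v, hV'l⟩ := hD V hV
  exact ⟨V', hV', by rw [hV'v, hVv], by omega⟩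

/-! ### Loops of a quasiconvex abelian subgroup -/

/-- The element `b` of `H` is *pumpable with period `n`* if, up to a fixed factor in `H`, its powers
`b ^ k` are represented by words of the language of length `k * n` up to an additive constant. -/
def IsPumpable (H : Subgroup G) (b : H) (n : ℕ) : Prop :=
  0 < n ∧ ∃ (h₀ : H) (m : ℕ), ∀ k : ℕ, ∃ W ∈ S.lang,
    wordValue S.μ W = (h₀ * b ^ k : H) ∧ W.length = m + k * n

/-- `l` is a sequence of loops from `B` whose lengths have sum at most `n`, and whose removal from
a word with value `h` leaves a remainder in `R`. -/
def IsLoopDecomposition {H : Subgroup G} (B : Set (H × ℕ)) (R : Set H) (h : H) (n : ℕ)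
    (l : List (H × ℕ)) : Prop :=
  (∀ p ∈ l, p ∈ B) ∧ (l.map Prod.snd).sum ≤ n ∧ ∃ r ∈ R, h = (l.map Prod.fst).prod * r

variable {S} in
open scoped IsMulCommutative in
/-- Loops can be removed from a word of the language with value in a quasiconvex abelian subgroup
until it is short, and there are only finitely many loops: as the subgroup is abelian, the
element by which the removal of a loop changes the value depends only on the position of the loop
relative to the subgroup, and not on its position along it. -/
theorem IsQuasiconvex.exists_finite_loops {H : Subgroup G} [IsMulCommutative H]
    (hqc : S.IsQuasiconvex H) :
    ∃ B : Set (H × ℕ), B.Finite ∧ (∀ p ∈ B, S.IsPumpable H p.1 p.2) ∧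
      ∃ R : Set H, R.Finite ∧ ∀ W ∈ S.lang, ∀ h : H, wordValue S.μ W = h →
        ∃ l, IsLoopDecomposition B R h W.length l := by
  have := S.finite_alphabet
  obtain ⟨κ, hκ⟩ := hqc
  have hball := finite_setOf_wordNorm_le S.generates κ
  obtain ⟨N, hN⟩ := S.regular.exists_pumping hball
  refine ⟨{p | S.IsPumpable H p.1 p.2 ∧ ∃ y ∈ {g | wordNorm S.μ g ≤ κ},
    ∃ U ∈ {U : List A | U.length ≤ N}, y⁻¹ * wordValue S.μ U * y = p.1 ∧ U.length = p.2},
    ?_, fun p hp => hp.1, {r | ∃ U ∈ {U : List A | U.length ≤ N}, wordValue S.μ U = r}, ?_, ?_⟩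
  · refine Set.Finite.of_finite_image (f := Prod.map Subtype.val _root_.id) ?_
      (Subtype.val_injective.prodMap Function.injective_id).injOn
    refine (hball.image2 (fun y U => (y⁻¹ * wordValue S.μ U * y, U.length))
      (List.finite_length_le A N)).subset ?_
    rintro _ ⟨p, ⟨-, y, hy, U, hU, h1, h2⟩, rfl⟩
    exact ⟨y, hy, U, hU, Prod.ext h1 h2⟩
  · refine Set.Finite.of_finite_image (f := Subtype.val) ?_ Subtype.val_injective.injOn
    refine ((List.finite_length_le A N).image (wordValue S.μ)).subset ?_
    rintro _ ⟨r, ⟨U, hU, h⟩, rfl⟩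
    exact ⟨U, hU, h⟩
  intro W
  induction hn : W.length using Nat.strong_induction_on generalizing W with
  | _ n ih =>
  subst hn
  intro hW h hWh
  by_cases hlen : W.length ≤ N
  · exact ⟨[], by simp, by simp, h, ⟨W, hlen, hWh⟩, by simp⟩
  have hnear := hκ W hW (hWh ▸ h.2)
  simp only [pathVertex, one_mul, wordDist] at hnear
  choose v hvH hv using hnear
  obtain ⟨W₁, U, W₂, rfl, hU, -, hl, hf, hpump⟩ := hN W hW
    (fun t => (wordValue S.μ (W.take t))⁻¹ * v t) 0 (by omega) (fun t _ _ => hv t)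
  have htake₁ : (W₁ ++ U ++ W₂).take W₁.length = W₁ := by simp
  have htake₂ : (W₁ ++ U ++ W₂).take (W₁.length + U.length) = W₁ ++ U := by
    rw [← List.length_append, List.take_left']
    rfl
  have hy := hv W₁.length
  simp only [htake₁, htake₂] at hf hy
  set a : H := ⟨v W₁.length, hvH _⟩
  set c : H := ⟨v (W₁.length + U.length), hvH _⟩
  change (wordValue S.μ W₁)⁻¹ * (a : G) = (wordValue S.μ (W₁ ++ U))⁻¹ * (c : G) at hf
  change wordNorm S.μ ((wordValue S.μ W₁)⁻¹ * (a : G)) ≤ κ at hy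
  -- conjugating the loop back to `H` from either side gives the same element
  have hb₁ : ((wordValue S.μ W₁)⁻¹ * (a : G))⁻¹ * wordValue S.μ U *
      ((wordValue S.μ W₁)⁻¹ * (a : G)) = (a⁻¹ * c : H) := by
    have : (c : G) = wordValue S.μ (W₁ ++ U) * ((wordValue S.μ W₁)⁻¹ * (a : G)) := by
      rw [hf]; group
    rw [Subgroup.coe_mul, this, wordValue_append, Subgroup.coe_inv]
    group
  set b : H := a⁻¹ * c
  have hb₂ : wordValue S.μ W₁ * wordValue S.μ U * (wordValue S.μ W₁)⁻¹ = b := by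
    have : b = a * b * a⁻¹ := by rw [mul_comm a b]; group
    rw [this]
    push_cast
    rw [← hb₁]
    group
  have hpow (k : ℕ) : wordValue S.μ (W₁ ++ (List.replicate k U).flatten ++ W₂) =
      (b⁻¹ * h * b ^ k : H) := by
    have h2 : wordValue S.μ W₁ * wordValue S.μ U ^ k = b ^ k * wordValue S.μ W₁ := by
      rw [← hb₂, conj_pow]; group
    have h3 : wordValue S.μ W₁ * wordValue S.μ U = b * wordValue S.μ W₁ := by
      rw [← hb₂]; group
    have h4 : (h : G) = b * (wordValue S.μ W₁ * wordValue S.μ W₂) := by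
      rw [← hWh, wordValue_append, wordValue_append, h3, mul_assoc]
    rw [mul_comm _ (b ^ k)]
    push_cast
    rw [h4, wordValue_append, wordValue_append, wordValue_flatten_replicate, h2]
    group
  have hUpos := List.length_pos_iff.2 hU
  have hpumpable : S.IsPumpable H b U.length :=
    ⟨hUpos, b⁻¹ * h, W₁.length + W₂.length, fun k => ⟨_, hpump k, hpow k, by
      simp only [List.length_append, List.length_flatten, List.map_replicate, List.sum_replicate,
        smul_eq_mul]
      ring⟩⟩
  have h0 := hpump 0
  have h0v := hpow 0
  simp only [List.replicate_zero, List.flatten_nil, List.append_nil, pow_zero, mul_one] at h0 h0v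
  obtain ⟨l, hlB, hls, r, hr, hprod⟩ :=
    ih (W₁ ++ W₂).length (by simp; omega) (W₁ ++ W₂) rfl h0 _ h0v
  refine ⟨(b, U.length) :: l, ?_, ?_, r, hr, ?_⟩
  · rintro p hp
    rcases List.mem_cons.1 hp with rfl | hp
    · exact ⟨hpumpable, _, hy, U, by simp; omega, hb₁, rfl⟩
    · exact hlB p hp
  · simp only [List.map_cons, List.sum_cons, List.length_append] at hls ⊢
    omega
  · rw [List.map_cons, List.prod_cons, mul_assoc, ← hprod]
    group

end BiautomaticStructure

/-! ### Linear symmetries of polytopes -/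

/-- A linear automorphism preserving a polytope permutes its finitely many extreme points, and it
is determined by their images if the polytope spans the space. -/
theorem finite_setOf_linearEquiv_image_convexHull_eq {V : Type*} [AddCommGroup V] [Module ℝ V]
    [TopologicalSpace V] [T2Space V] [IsTopologicalAddGroup V] [ContinuousSMul ℝ V]
    [LocallyConvexSpace ℝ V] [FiniteDimensional ℝ V] {E : Set V} (hE : E.Finite)
    (hspan : Submodule.span ℝ E = ⊤) :
    {T : V ≃ₗ[ℝ] V | T '' convexHull ℝ E = convexHull ℝ E}.Finite := by
  set P := convexHull ℝ E
  have : Finite (P.extremePoints ℝ) := hE.subset extremePoints_convexHull_subset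
  have hmaps (T : {T : V ≃ₗ[ℝ] V | T '' P = P}) (x : P.extremePoints ℝ) :
      T.1 x ∈ P.extremePoints ℝ := by
    have h : T.1 '' P.extremePoints ℝ = P.extremePoints ℝ := by
      rw [image_extremePoints, T.2]
    exact h.subset (Set.mem_image_of_mem _ x.2)
  refine Set.finite_coe_iff.1 (Finite.of_injective (β := P.extremePoints ℝ → P.extremePoints ℝ)
    (fun T x => ⟨T.1 x, hmaps T x⟩) fun T T' h => ?_)
  have heq : Set.EqOn T.1.toLinearMap T'.1.toLinearMap (P.extremePoints ℝ) := fun x hx =>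
    congrArg Subtype.val (congrFun h ⟨x, hx⟩)
  have hker : IsClosed (LinearMap.ker (T.1.toLinearMap - T'.1.toLinearMap) : Set V) :=
    Submodule.closed_of_finiteDimensional _
  have hsub : P ⊆ (LinearMap.ker (T.1.toLinearMap - T'.1.toLinearMap) : Set V) := by
    refine (closure_convexHull_extremePoints (hE.isCompact_convexHull ℝ)
      (convex_convexHull ℝ E)).ge.trans
      (closure_minimal (convexHull_min (fun x hx => ?_) (Submodule.convex _)) hker)
    simpa [sub_eq_zero] using heq hx
  refine Subtype.ext (LinearEquiv.toLinearMap_injective (LinearMap.ext_on hspan fun x hx => ?_))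
  simpa [sub_eq_zero] using hsub (subset_convexHull ℝ E hx)

open scoped Pointwise in
theorem sum_mem_smul_convex {ι V : Type*} [AddCommGroup V] [Module ℝ V] {P : Set V}
    (hP : Convex ℝ P) (h0 : (0 : V) ∈ P) (v : ι → V) (n : ι → ℕ) (l : List ι)
    (hl : ∀ i ∈ l, 0 < n i ∧ (n i : ℝ)⁻¹ • v i ∈ P) {c : ℝ} (hc : ((l.map n).sum : ℝ) ≤ c) :
    (l.map v).sum ∈ c • P := by
  have key : (l.map v).sum ∈ ((l.map n).sum : ℝ) • P := by
    clear hc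
    induction l with
    | nil => exact ⟨0, h0, by simp⟩
    | cons i l ih =>
      obtain ⟨hpos, hi⟩ := hl i (by simp)
      have hpos' : (n i : ℝ) ≠ 0 := by positivity
      rw [List.map_cons, List.map_cons, List.sum_cons, List.sum_cons, Nat.cast_add,
        hP.add_smul (by positivity) (by positivity)]
      exact Set.add_mem_add ⟨_, hi, smul_inv_smul₀ hpos' _⟩
        (ih fun j hj => hl j (List.mem_cons_of_mem _ hj))
  have hs : (0 : ℝ) ≤ ((l.map n).sum : ℝ) := by positivity
  rw [show c = (l.map n).sum + (c - (l.map n).sum) by ring, hP.add_smul hs (by linarith)]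
  exact ⟨_, key, 0, ⟨0, h0, by simp⟩, by simp⟩

open Filter Topology Pointwise in
/-- A closed set contains `y` as soon as its dilations by a factor `t + O(1)` contain `t • y` up to
a bounded error, for arbitrarily large `t`. -/
theorem mem_of_forall_smul_sub_mem_smul {V : Type*} [NormedAddCommGroup V] [NormedSpace ℝ V]
    {P : Set V} (hP : IsClosed P) {R : Set V} (hR : R.Finite) {M : ℕ} (hM : 0 < M) {c : ℕ} {y : V}
    (h : ∀ j : ℕ, ∃ r ∈ R, ((j * M : ℕ) : ℝ) • y - r ∈ ((j * M + c : ℕ) : ℝ) • P) : y ∈ P := by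
  choose r hr x hx hxy using h
  obtain ⟨D, hD⟩ := hR.isBounded.exists_norm_le
  have ht : Tendsto (fun j : ℕ => ((j * M + c : ℕ) : ℝ)) atTop atTop :=
    tendsto_natCast_atTop_atTop.comp (tendsto_atTop_mono (fun j =>
      (Nat.le_mul_of_pos_right j hM).trans (Nat.le_add_right _ c)) tendsto_id)
  refine hP.mem_of_tendsto (f := x) (b := atTop) ?_ (Eventually.of_forall hx)
  rw [tendsto_iff_norm_sub_tendsto_zero]
  have hlim : Tendsto (fun j : ℕ => (c * ‖y‖ + D) / ((j * M + c : ℕ) : ℝ)) atTop (𝓝 0) :=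
    tendsto_const_nhds.div_atTop ht
  refine squeeze_zero' (Eventually.of_forall fun j => norm_nonneg _) ?_ hlim
  filter_upwards [ht.eventually_gt_atTop 0] with j hj
  rw [le_div_iff₀ hj, mul_comm, ← Real.norm_of_nonneg hj.le, ← norm_smul, smul_sub]
  have h1 : ((j * M + c : ℕ) : ℝ) • x j - ((j * M + c : ℕ) : ℝ) • y = -((c : ℝ) • y) - r j := by
    have := hxy j
    simp only at this
    rw [this]
    push_cast
    module
  rw [h1]
  refine (norm_sub_le _ _).trans ?_
  rw [norm_neg, norm_smul, Real.norm_natCast]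
  gcongr
  exact hD _ (hr j)

/-! ### Finitely generated abelian groups modulo torsion -/

/-- A finitely generated abelian group is, up to a finite kernel, a lattice spanning a real vector
space `ι → ℝ`, so that homomorphisms from it to real vector spaces extend to linear maps. -/
theorem exists_addMonoidHom_pi_real (M : Type*) [AddCommGroup M] [Module.Finite ℤ M] :
    ∃ (ι : Type) (_ : Fintype ι) (π : M →+ (ι → ℝ)), Finite π.ker ∧
      Submodule.span ℝ (Set.range π) = ⊤ ∧
      ∀ (f : M →+ (ι → ℝ)), ∃ T : (ι → ℝ) →ₗ[ℝ] (ι → ℝ), ∀ a, T (π a) = f a := by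
  have hfree : Module.Free ℤ (M ⧸ Submodule.torsion ℤ M) :=
    Module.free_of_finite_type_torsion_free'
  let b := Module.finBasis ℤ (M ⧸ Submodule.torsion ℤ M)
  let q := (Submodule.torsion ℤ M).mkQ
  let π : M →+ (Fin (Module.finrank ℤ (M ⧸ Submodule.torsion ℤ M)) → ℝ) :=
    { toFun := fun a i => (b.repr (q a) i : ℝ)
      map_zero' := by ext; simp
      map_add' := fun x y => by ext; simp }
  have hπ (a : M) (i) : π a i = (b.repr (q a) i : ℝ) := rfl
  refine ⟨_, inferInstance, π, ?_, ?_, fun f => ?_⟩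
  · have hfin : Finite (Submodule.torsion ℤ M) :=
      Module.finite_of_fg_torsion _ (Submodule.torsion_isTorsion)
    refine Finite.Set.subset (Submodule.torsion ℤ M : Set M) fun a ha => ?_
    have h0 : b.repr (q a) = 0 := by
      ext i
      have : (b.repr (q a) i : ℝ) = 0 := congrFun (show π a = 0 from ha) i
      simpa using this
    rw [EmbeddingLike.map_eq_zero_iff] at h0
    exact (Submodule.Quotient.mk_eq_zero _).1 h0
  · rw [eq_top_iff, ← (Pi.basisFun ℝ _).span_eq, Submodule.span_le]
    rintro _ ⟨i, rfl⟩
    obtain ⟨a, ha⟩ := Submodule.mkQ_surjective _ (b i)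
    refine Submodule.subset_span ⟨a, ?_⟩
    ext j
    rw [hπ, show q a = b i from ha]
    simp [Finsupp.single_apply, Pi.single_apply, eq_comm]
  · have hf : Submodule.torsion ℤ M ≤ LinearMap.ker f.toIntLinearMap := by
      rintro a ⟨n, hn⟩
      have h1 : (n : ℤ) • f a = 0 := by
        rw [← map_zsmul]
        exact (congrArg f hn).trans (map_zero f)
      exact (smul_eq_zero.1 h1).resolve_left (nonZeroDivisors.ne_zero n.2)
    let f' := (Submodule.torsion ℤ M).liftQ f.toIntLinearMap hf
    refine ⟨(Pi.basisFun ℝ _).constr ℝ fun i => f' (b i), fun a => ?_⟩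
    calc _ = ∑ i, b.repr (q a) i • f' (b i) := by
          rw [Module.Basis.constr_apply_fintype]
          exact Finset.sum_congr rfl fun i _ => by
            rw [Pi.basisFun_equivFun, LinearEquiv.refl_apply, hπ, Int.cast_smul_eq_zsmul]
      _ = f' (∑ i, b.repr (q a) i • b i) := by rw [map_sum]; simp only [map_zsmul]
      _ = f a := by rw [b.sum_repr]; rfl

theorem map_ofMul_list_prod {M N ι : Type*} [Monoid M] [AddMonoid N] (π : Additive M →+ N)
    (l : List ι) (f : ι → M) :
    π (.ofMul (l.map f).prod) = (l.map fun i => π (.ofMul (f i))).sum := by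
  induction l with
  | nil => simp
  | cons i l ih =>
    rw [List.map_cons, List.map_cons, List.prod_cons, List.sum_cons, ofMul_mul, map_add, ih]

/-! ### Partial isomorphisms of finitely generated abelian groups -/

namespace PartialIso

/-- Partial isomorphisms of an abelian group that agree modulo a finite subgroup agree on a
subgroup of finite index. -/
theorem equivalent_of_finite {M : Type*} [CommGroup M] {φ ψ : PartialIso M} (F : Subgroup M)
    [Finite F] (h : ∀ (x : M) (hφ : x ∈ φ.dom) (hψ : x ∈ ψ.dom),
      (φ.toEquiv ⟨x, hφ⟩ : M) * (ψ.toEquiv ⟨x, hψ⟩ : M)⁻¹ ∈ F) : φ.Equivalent ψ := by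
  have := φ.finiteIndex_dom
  have := ψ.finiteIndex_dom
  let δ : (φ.dom ⊓ ψ.dom : Subgroup M) →* F :=
    { toFun := fun x => ⟨_, h x x.2.1 x.2.2⟩
      map_one' := Subtype.ext (by
        change (φ.toEquiv 1 : M) * (ψ.toEquiv 1 : M)⁻¹ = 1
        rw [map_one, map_one]
        simp)
      map_mul' := fun x y => Subtype.ext (by
        have h1 := congrArg Subtype.val (map_mul φ.toEquiv ⟨x, x.2.1⟩ ⟨y, y.2.1⟩)
        have h2 := congrArg Subtype.val (map_mul ψ.toEquiv ⟨x, x.2.2⟩ ⟨y, y.2.2⟩)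
        change (φ.toEquiv (⟨x, x.2.1⟩ * ⟨y, y.2.1⟩) : M) *
          (ψ.toEquiv (⟨x, x.2.2⟩ * ⟨y, y.2.2⟩) : M)⁻¹ = _ * _⁻¹ * (_ * _⁻¹)
        rw [h1, h2, Subgroup.coe_mul, Subgroup.coe_mul, mul_inv, mul_mul_mul_comm]) }
  have hmem {x : M} (hx : x ∈ δ.ker.map (φ.dom ⊓ ψ.dom).subtype) :
      ∃ h : x ∈ φ.dom ⊓ ψ.dom, δ ⟨x, h⟩ = 1 := by
    obtain ⟨y, hy, rfl⟩ := hx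
    exact ⟨y.2, hy⟩
  refine ⟨δ.ker.map (φ.dom ⊓ ψ.dom).subtype, ⟨?_⟩, fun x hx => (hmem hx).1.1,
    fun x hx => (hmem hx).1.2, fun x hx => ?_⟩
  · rw [Subgroup.index_map_subtype]
    exact mul_ne_zero (Subgroup.finiteIndex_ker δ).index_ne_zero
      Subgroup.FiniteIndex.index_ne_zero
  · obtain ⟨h1, h2⟩ := hmem hx
    exact mul_inv_eq_one.1 (congrArg Subtype.val h2)

variable {M V : Type*} [CommGroup M] [AddCommGroup V] [Module ℝ V] (φ : PartialIso M)
  (π : Additive M →+ V)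

/-- A partial isomorphism of an abelian group extends linearly to any vector space to which the
endomorphisms of the group extend. -/
theorem exists_linearMap (hext : ∀ f : Additive M →+ V, ∃ T : V →ₗ[ℝ] V, ∀ a, T (π a) = f a) :
    ∃ T : V →ₗ[ℝ] V, ∀ x : φ.dom, T (π (.ofMul (x : M))) = π (.ofMul (φ.toEquiv x : M)) := by
  have hn := φ.finiteIndex_dom.index_ne_zero
  let α : M →* M := (φ.cod.subtype.comp φ.toEquiv.toMonoidHom).comp
    ((powMonoidHom φ.dom.index).codRestrict φ.dom fun a => φ.dom.pow_index_mem a)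
  obtain ⟨T, hT⟩ := hext (π.comp α.toAdditive)
  refine ⟨(φ.dom.index : ℝ)⁻¹ • T, fun x => ?_⟩
  have hα : α x = (φ.toEquiv x : M) ^ φ.dom.index := by
    have : φ.toEquiv (x ^ φ.dom.index) = φ.toEquiv x ^ φ.dom.index := map_pow _ _ _
    exact congrArg Subtype.val this
  have h1 : T (π (.ofMul (x : M))) = (φ.dom.index : ℝ) • π (.ofMul (φ.toEquiv x : M)) := by
    rw [hT, Nat.cast_smul_eq_nsmul, ← map_nsmul, ← ofMul_pow, ← hα]
    rfl
  rw [LinearMap.smul_apply, h1, inv_smul_smul₀ (Nat.cast_ne_zero.2 hn)]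

variable {π} in
theorem span_image_dom (hspan : Submodule.span ℝ (Set.range π) = ⊤) :
    Submodule.span ℝ (Set.range fun x : φ.dom => π (.ofMul (x : M))) = ⊤ := by
  rw [eq_top_iff, ← hspan, Submodule.span_le]
  rintro _ ⟨a, rfl⟩
  have hn := φ.finiteIndex_dom.index_ne_zero
  have h : (φ.dom.index : ℝ) • π a ∈
      Submodule.span ℝ (Set.range fun x : φ.dom => π (.ofMul (x : M))) := by
    refine Submodule.subset_span ⟨⟨_, φ.dom.pow_index_mem a.toMul⟩, ?_⟩
    rw [Nat.cast_smul_eq_nsmul, ← map_nsmul]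
    rfl
  exact (Submodule.smul_mem_iff _ (Nat.cast_ne_zero.2 hn)).1 h

theorem exists_linearEquiv (hspan : Submodule.span ℝ (Set.range π) = ⊤)
    (hext : ∀ f : Additive M →+ V, ∃ T : V →ₗ[ℝ] V, ∀ a, T (π a) = f a) :
    ∃ T : V ≃ₗ[ℝ] V, ∀ x : φ.dom, T (π (.ofMul (x : M))) = π (.ofMul (φ.toEquiv x : M)) := by
  obtain ⟨T, hT⟩ := φ.exists_linearMap π hext
  obtain ⟨T', hT'⟩ := φ.symm.exists_linearMap π hext
  refine ⟨LinearEquiv.ofLinearMap T T' (LinearMap.ext_on_range (φ.symm.span_image_dom hspan) ?_)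
    (LinearMap.ext_on_range (φ.span_image_dom hspan) ?_), hT⟩
  · intro y
    have h := hT (φ.symm.toEquiv y)
    rw [LinearMap.comp_apply, hT', LinearMap.id_apply]
    exact h.trans (by rw [show φ.toEquiv (φ.symm.toEquiv y) = y from φ.toEquiv.apply_symm_apply y])
  · intro x
    have h := hT' (φ.toEquiv x)
    rw [LinearMap.comp_apply, hT, LinearMap.id_apply]
    exact h.trans (by
      rw [show φ.symm.toEquiv (φ.toEquiv x) = x from φ.toEquiv.symm_apply_apply x])

end PartialIso

namespace BiautomaticStructure

variable {G : Type*} [Group G] {A : Type*} (S : BiautomaticStructure G A) {H : Subgroup G}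

/-! ### The polytope of loops -/

/-- The polytope spanned by the origin and by the directions `b / n` of the loops `(b, n) ∈ B`,
where `π` realizes the subgroup `H` in a real vector space. -/
def loopPolytope {V : Type*} [AddCommGroup V] [Module ℝ V] (π : Additive H →+ V)
    (B : Set (H × ℕ)) : Set V :=
  convexHull ℝ (insert 0 ((fun p => (p.2 : ℝ)⁻¹ • π (.ofMul p.1)) '' B))

variable {V : Type*} [NormedAddCommGroup V] [NormedSpace ℝ V] (π : Additive H →+ V)
  {B : Set (H × ℕ)} {R : Set H}

/-- Conjugation maps the polytope of loops into itself: the conjugates of the powers of a loop are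
represented by words which are not much longer, and these consist of loops again. -/
theorem image_loopPolytope_subset (hBfin : B.Finite) (hB : ∀ p ∈ B, S.IsPumpable H p.1 p.2)
    (hRfin : R.Finite) (hdec : ∀ W ∈ S.lang, ∀ h : H, wordValue S.μ W = h →
      ∃ l, IsLoopDecomposition B R h W.length l)
    {g : G} (hg : ∀ b : H, ∃ N : ℕ, 0 < N ∧ g * b ^ N * g⁻¹ ∈ H) {T : V →ₗ[ℝ] V}
    (hT : ∀ x y : H, g * x * g⁻¹ = y → T (π (.ofMul x)) = π (.ofMul y)) :
    T '' loopPolytope π B ⊆ loopPolytope π B := by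
  rw [loopPolytope, LinearMap.image_convexHull]
  refine convexHull_min ?_ (convex_convexHull ℝ _)
  rintro _ ⟨_, rfl | ⟨⟨b, n⟩, hp, rfl⟩, rfl⟩
  · rw [map_zero]
    exact subset_convexHull ℝ _ (Set.mem_insert _ _)
  obtain ⟨hn, h₀, m, hpump⟩ := hB _ hp
  obtain ⟨C, hC⟩ := S.exists_length_le (g * (h₀ : G)⁻¹) g⁻¹
  obtain ⟨N, hN, hNH⟩ := hg b
  refine mem_of_forall_smul_sub_mem_smul (((hBfin.image _).insert 0).isClosed_convexHull ℝ)
    (hRfin.image fun r => π (.ofMul r)) (Nat.mul_pos hN hn) (c := m + C) fun j => ?_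
  obtain ⟨W, hW, hWv, hWl⟩ := hpump (j * N)
  obtain ⟨U, hU, hUv, hUl⟩ := hC W hW
  set y : H := ⟨g * b ^ N * g⁻¹, hNH⟩ ^ j with hy
  have hby : g * (b ^ (j * N) : H) * g⁻¹ = y := by
    rw [hy, mul_comm j N, pow_mul]
    push_cast
    rw [conj_pow]
  have hUy : wordValue S.μ U = y := by
    rw [hUv, hWv, ← hby]
    push_cast
    group
  obtain ⟨l, hl, hls, r, hr, hprod⟩ := hdec U hU y hUy
  refine ⟨_, ⟨r, hr, rfl⟩, ?_⟩
  have hπy : ((j * (N * n) : ℕ) : ℝ) • T ((n : ℝ)⁻¹ • π (.ofMul b)) = π (.ofMul y) := by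
    rw [← hT _ y hby, ofMul_pow, map_nsmul, map_nsmul, map_smul, ← mul_assoc, Nat.cast_mul,
      mul_smul, smul_inv_smul₀ (Nat.cast_ne_zero.2 hn.ne'), Nat.cast_smul_eq_nsmul]
  simp only
  rw [hπy, hprod, ofMul_mul, map_add, add_sub_cancel_right, map_ofMul_list_prod]
  refine sum_mem_smul_convex (convex_convexHull ℝ _) (subset_convexHull ℝ _ (Set.mem_insert _ _))
    (fun p => π (.ofMul p.1)) Prod.snd l ?_ ?_
  · exact fun p hp => ⟨(hB p (hl p hp)).1, subset_convexHull ℝ _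
      (Set.mem_insert_of_mem _ ⟨p, hl p hp, rfl⟩)⟩
  rw [Nat.cast_le]
  calc (l.map Prod.snd).sum ≤ m + j * N * n + C :=
        hls.trans (hUl.trans (Nat.add_le_add_right hWl.le C))
    _ = _ := by ring

/-- The directions of the loops span the space, as infinitely many powers of an element of `H` have
the same remainder after the removal of all loops. -/
theorem span_loops_eq_top (hRfin : R.Finite) (hdec : ∀ W ∈ S.lang, ∀ h : H,
      wordValue S.μ W = h → ∃ l, IsLoopDecomposition B R h W.length l)
    (hB : ∀ p ∈ B, 0 < p.2) (hspan : Submodule.span ℝ (Set.range π) = ⊤) :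
    Submodule.span ℝ (insert 0 ((fun p => (p.2 : ℝ)⁻¹ • π (.ofMul p.1)) '' B)) = ⊤ := by
  set E := Submodule.span ℝ (insert 0 ((fun p => (p.2 : ℝ)⁻¹ • π (.ofMul p.1)) '' B))
  have hloop : ∀ p ∈ B, π (.ofMul p.1) ∈ E := fun p hp =>
    (Submodule.smul_mem_iff _ (inv_ne_zero (Nat.cast_ne_zero.2 (hB p hp).ne'))).1
      (Submodule.subset_span (Set.mem_insert_of_mem _ ⟨p, hp, rfl⟩))
  have hrem (h : H) : ∃ r : R, π (.ofMul h) - π (.ofMul (r : H)) ∈ E := by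
    obtain ⟨W, hW, hWv⟩ := S.lang_surjective h
    obtain ⟨l, hl, -, r, hr, rfl⟩ := hdec W hW h hWv
    refine ⟨⟨r, hr⟩, ?_⟩
    rw [ofMul_mul, map_add, add_sub_cancel_right, map_ofMul_list_prod]
    refine list_sum_mem fun x hx => ?_
    obtain ⟨p, hp, rfl⟩ := List.mem_map.1 hx
    exact hloop p (hl p hp)
  rw [eq_top_iff, ← hspan, Submodule.span_le]
  rintro _ ⟨a, rfl⟩
  choose r hr using fun k : ℕ => hrem (a.toMul ^ k)
  have := hRfin.to_subtype
  obtain ⟨i, j, hij, hrij⟩ := Finite.exists_ne_map_eq_of_infinite r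
  have h := E.sub_mem (hr i) (hr j)
  rw [hrij, sub_sub_sub_cancel_right, ofMul_pow, ofMul_pow, ofMul_toMul, map_nsmul, map_nsmul,
    ← Nat.cast_smul_eq_nsmul ℝ, ← Nat.cast_smul_eq_nsmul ℝ, ← sub_smul] at h
  exact (Submodule.smul_mem_iff _ (sub_ne_zero.2 (Nat.cast_injective.ne hij))).1 h

theorem fg_of_isLoopDecomposition (hBfin : B.Finite) (hRfin : R.Finite)
    (hdec : ∀ W ∈ S.lang, ∀ h : H, wordValue S.μ W = h →
      ∃ l, IsLoopDecomposition B R h W.length l) : Group.FG H := by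
  refine Group.fg_iff.2 ⟨Prod.fst '' B ∪ R, ?_, (hBfin.image _).union hRfin⟩
  refine eq_top_iff.2 fun h _ => ?_
  obtain ⟨W, hW, hWv⟩ := S.lang_surjective h
  obtain ⟨l, hl, -, r, hr, rfl⟩ := hdec W hW h hWv
  refine mul_mem (list_prod_mem fun x hx => ?_) (Subgroup.subset_closure (Or.inr hr))
  obtain ⟨p, hp, rfl⟩ := List.mem_map.1 hx
  exact Subgroup.subset_closure (Or.inl ⟨p, hl p hp, rfl⟩)

end BiautomaticStructure

/-! ### Finiteness of the image in the abstract commensurator -/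

open Subgroup.Commensurable

open scoped IsMulCommutative in
theorem BiautomaticStructure.IsQuasiconvex.finite_range_commensuratorMap {G : Type*} [Group G]
    {A : Type*} {S : BiautomaticStructure G A} {H : Subgroup G} [IsMulCommutative H]
    (hqc : S.IsQuasiconvex H) : Finite (commensuratorMap H).range := by
  obtain ⟨B, hBfin, hB, R, hRfin, hdec⟩ := hqc.exists_finite_loops
  have hfg := S.fg_of_isLoopDecomposition hBfin hRfin hdec
  have : Module.Finite ℤ (Additive H) :=
    Module.Finite.iff_addGroup_fg.2 (GroupFG.iff_add_fg.1 hfg)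
  obtain ⟨ι, _, π, hker, hspan, hext⟩ := exists_addMonoidHom_pi_real (Additive H)
  choose T hT using fun g : commensurator H => (conjPartialIso H g).exists_linearEquiv π hspan hext
  have hTconj (g : commensurator H) (x y : H) (hxy : (g : G) * x * (g : G)⁻¹ = y) :
      T g (π (.ofMul x)) = π (.ofMul y) := by
    refine (hT g ⟨x, mem_conjDom.2 (hxy ▸ y.2)⟩).trans ?_
    congr 2
    exact Subtype.ext hxy
  have hpow (g : commensurator H) (b : H) :
      ∃ N : ℕ, 0 < N ∧ (g : G) * b ^ N * (g : G)⁻¹ ∈ H := by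
    have := finiteIndex_conjDom H g
    exact ⟨(conjDom H (g : G)).index, Nat.pos_of_ne_zero Subgroup.FiniteIndex.index_ne_zero,
      (conjDom H (g : G)).pow_index_mem b⟩
  have hmem (g : commensurator H) :
      T g '' loopPolytope π B = loopPolytope π B := by
    refine (S.image_loopPolytope_subset π hBfin hB hRfin hdec (hpow g)
      (T := (T g).toLinearMap) (hTconj g)).antisymm fun v hv => ?_
    have hinv := S.image_loopPolytope_subset π hBfin hB hRfin hdec (hpow g⁻¹)
      (T := (T g).symm.toLinearMap) (fun x y hxy => ?_)
    · exact ⟨(T g).symm v, hinv ⟨v, hv, rfl⟩, (T g).apply_symm_apply v⟩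
    · refine (T g).symm_apply_eq.2 (hTconj g y x ?_).symm
      rw [← hxy]
      push_cast
      group
  have hfin := finite_setOf_linearEquiv_image_convexHull_eq ((hBfin.image _).insert 0)
    (S.span_loops_eq_top π hRfin hdec (fun p hp => (hB p hp).1) hspan)
  have hfinT : Finite (Set.range T) := hfin.subset (Set.range_subset_iff.2 hmem)
  -- elements inducing the same linear map agree modulo the finite kernel of `π`
  have hfactor (g g' : commensurator H) (h : T g = T g') :
      commensuratorMap H g = commensuratorMap H g' := by
    have : Finite π.ker.toSubgroup' := hker
    refine Quotient.sound (PartialIso.equivalent_of_finite π.ker.toSubgroup' fun x hx hx' => ?_)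
    have h1 := hT g ⟨x, hx⟩
    have h2 := hT g' ⟨x, hx'⟩
    change π (.ofMul (_ * _⁻¹)) = 0
    rw [ofMul_mul, ofMul_inv, map_add, map_neg, ← h1, ← h2, h, add_neg_cancel]
  choose g hg using fun c : (commensuratorMap H).range => c.2
  refine Finite.of_injective (β := Set.range T) (fun c => ⟨T (g c), g c, rfl⟩) fun c c' h => ?_
  rw [Subtype.ext_iff, ← hg c, ← hg c']
  exact hfactor _ _ (congrArg Subtype.val h)

/-- A finitely generated group of elements which act trivially on `H` up to finite index centralizes
a subgroup of finite index. -/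
theorem exists_centralized_of_fg_of_le_ker {G : Type*} [Group G] {H : Subgroup G}
    {F : Subgroup (commensurator H)} (hF : F ≤ (commensuratorMap H).ker) (hfg : F.FG) :
    ∃ K : Subgroup G, K ≤ H ∧ K.relIndex H ≠ 0 ∧ ∀ f ∈ F, ∀ k ∈ K, (f : G) * k = k * (f : G) := by
  obtain ⟨s, rfl⟩ := hfg
  have hs (f : s) : ∃ K : Subgroup H, K.FiniteIndex ∧ ∀ k ∈ K, (f : G) * k = k * (f : G) := by
    have h1 : commensuratorMap H f = 1 := hF (Subgroup.subset_closure f.2)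
    obtain ⟨K, hK, h2, h3, h⟩ := Quotient.exact h1
    refine ⟨K, hK, fun k hk => ?_⟩
    have : (f : G) * k * (f : G)⁻¹ = k := congrArg Subtype.val (h k hk)
    exact mul_inv_eq_iff_eq_mul.1 this
  choose K hK hKs using hs
  refine ⟨(⨅ f, K f).map H.subtype, Subgroup.map_subtype_le _, ?_, ?_⟩
  · rw [Subgroup.relIndex, Subgroup.subgroupOf,
      Subgroup.comap_map_eq_self_of_injective H.subtype_injective]
    exact (Subgroup.finiteIndex_iInf hK).index_ne_zero
  · rintro f hf _ ⟨k, hk, rfl⟩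
    have hle : Subgroup.closure (s : Set (commensurator H)) ≤
        (Subgroup.centralizer {(k : G)}).comap (commensurator H).subtype := by
      refine (Subgroup.closure_le _).2 fun f hf => ?_
      exact Subgroup.mem_centralizer_singleton_iff.2
        (hKs ⟨f, hf⟩ k ((Subgroup.mem_iInf.1 hk) _))
    exact Subgroup.mem_centralizer_singleton_iff.1 (hle hf)

theorem theorem1p2 {G : Type*} [Group G] {A : Type*} (S : BiautomaticStructure G A)
    (H : Subgroup G) (hab : IsMulCommutative H) (hqc : S.IsQuasiconvex H) :
    Finite (commensuratorMap H).range ∧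
    ∃ N : Subgroup (Subgroup.Commensurable.commensurator H),
      N.Normal ∧ N.FiniteIndex ∧
      ∀ F : Subgroup (Subgroup.Commensurable.commensurator H), F ≤ N → F.FG →
        ∃ K : Subgroup G, K ≤ H ∧ K.relIndex H ≠ 0 ∧
          ∀ f ∈ F, ∀ k ∈ K, (f : G) * k = k * (f : G) := by
  have hfin := hqc.finite_range_commensuratorMap
  exact ⟨hfin, (commensuratorMap H).ker, inferInstance, Subgroup.finiteIndex_ker _,
    fun F hF hfg => exists_centralized_of_fg_of_le_ker hF hfg⟩
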